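/- Fix a finite non-empty alphabet $\Sigma=\{0,\dots,k-1\}$ ($k\ge 1$) and an integer $m\ge 1$. A *perfect binary tree* of height $h$ has internal nodes labelled by $\Sigma$ and all its leaves, at depth $h$, labelled by complex numbers. Trees are *compatible* if they have the same height and the same labels at all internal nodes; $t+t'$ (defined only for compatible trees) adds the leaves pointwise, and $c\cdot t$ multiplies all leaves by $c\in\mathbb C$. A *linear form* over a finite set $Q$ is a non-empty partial map $v:Q\rightharpoonup\mathbb C$; its domain is $\operatorname{supp}(v)$ (coefficient $0$ is distinguished from absence). A *synchronized weighted tree automaton* (SWTA) over $\Sigma$ is $A=(Q,\delta,C,q_0,E)$ with a finite set $Q$ of states, a finite non-empty set $C$ of colors, a root state $q_0\in Q$, leaf states $E\subseteq Q$, and a partial transition function $\delta$ from $Q\times\Sigma\times C$ to pairs of linear forms over $Q$. The partial function $[\![A,q]\!]$ from words over $\Sigma\times C$ to trees is defined as follows: $[\![A,q]\!](\epsilon)$ is the single leaf $1$ if $q\in E$ and is undefined otherwise; if $\delta(q,a,c)=(\ell,r)$, then $[\![A,q]\!]((a,c)u)$ is the tree with root label $a$ and the subtrees $\sum_{p\in\operatorname{supp}(\ell)}\ell[p]\cdot[\![A,p]\!](u)$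 and $\sum_{p\in\operatorname{supp}(r)}r[p]\cdot[\![A,p]\!](u)$ (undefined if $\delta(q,a,c)$ or any tree involved is undefined). The language $L(A)$ is the set of all trees $[\![A,q_0]\!](w)$ with $w\in(\Sigma\times C)^*$. As inputs of algorithms, SWTAs are given by finite tables, with states and colors numbered $0,1,2,\dots$, whose weights are algebraic numbers $\frac1{\sqrt{2^j}}\sum_{s=0}^{m-1}a_s\,\omega_m^s$ with $\omega_m=e^{i\pi/m}$, each written as the tuple $(a_0,\dots,a_{m-1},j)$ with $a_s\in\mathbb Z$ and $j\in\mathbb N$. **Theorem.** For every $k\ge1$ and every $m\ge1$ it is undecidable, given two such SWTAs $A$ and $B$ over $\Sigma$ (with possibly different sets of states and colors), whether $L(A)\cap L(B)=\emptyset$: there is no partial computable function that, on the codes of any two such SWTAs $A$ and $B$, halts and returns true if $L(A)\cap L(B)=\emptyset$, and halts and returns false otherwise. -/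

import Mathlib

/-! ### Perfect binary trees -/

/-- Perfect binary trees of a given height: internal nodes carry symbols from `Γ`, leaves carry
complex numbers. -/
inductive PTree (Γ : Type*) : ℕ → Type _
  | leaf (z : ℂ) : PTree Γ 0
  | node {h : ℕ} (a : Γ) (l r : PTree Γ h) : PTree Γ (h + 1)

namespace PTree

variable {Γ : Type*}

/-- `c · t`: multiply every leaf of `t` by `c`. -/
noncomputable def scale (c : ℂ) : {h : ℕ} → PTree Γ h → PTree Γ h
  | _, leaf z => leaf (c * z)
  | _, node a l r => node a (scale c l) (scale c r)

/-- `t + t'`: add up the leaves. It is defined iff the trees are compatible, that is, have the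
same labels at all internal nodes. -/
noncomputable def add [DecidableEq Γ] : {h : ℕ} → PTree Γ h → PTree Γ h → Option (PTree Γ h)
  | _, leaf z, leaf z' => some (leaf (z + z'))
  | _, node a l r, node a' l' r' =>
      if a = a' then do
        let tl ← add l l'
        let tr ← add r r'
        return node a tl tr
      else none

/-- Addition of possibly undefined trees; undefined as soon as one operand is. -/
noncomputable def addOpt [DecidableEq Γ] {h : ℕ} (x y : Option (PTree Γ h)) :
    Option (PTree Γ h) := do
  let s ← x
  let t ← y
  add s t

/-- The sum of a non-empty list of possibly undefined trees (there is no empty sum of trees). -/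
noncomputable def sum [DecidableEq Γ] {h : ℕ} : List (Option (PTree Γ h)) → Option (PTree Γ h)
  | [] => none
  | [x] => x
  | x :: y :: xs => addOpt x (sum (y :: xs))

theorem add_comm [DecidableEq Γ] {h : ℕ} (s t : PTree Γ h) : add s t = add t s := by
  induction s with
  | leaf z => cases t; simp [add, _root_.add_comm]
  | node a l r ihl ihr =>
    cases t with
    | node b l' r' =>
      by_cases hab : a = b
      · subst hab; simp [add, ihl, ihr]
      · simp [add, hab, Ne.symm hab]

theorem addOpt_comm [DecidableEq Γ] {h : ℕ} (x y : Option (PTree Γ h)) :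
    addOpt x y = addOpt y x := by
  cases x <;> cases y <;> simp [addOpt, add_comm]

theorem add_assoc [DecidableEq Γ] {h : ℕ} (s t u : PTree Γ h) :
    ((add s t).bind fun x => add x u) = (add t u).bind fun y => add s y := by
  induction s with
  | leaf z => cases t; cases u; simp [add, _root_.add_assoc]
  | node a l r ihl ihr =>
    cases t with
    | node b l' r' =>
      cases u with
      | node c l'' r'' =>
        have hl := ihl l' l''
        have hr := ihr r' r''
        by_cases hab : a = b
        · by_cases hbc : b = c
          · subst hab; subst hbc
            cases h1 : add l l' <;> cases h2 : add r r' <;> cases h3 : add l' l'' <;>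
              cases h4 : add r' r'' <;> simp_all [add]
            all_goals first | (rw [← hl]; simp) | (rw [← hr]; simp)
          · subst hab
            cases h1 : add l l' <;> cases h2 : add r r' <;> simp [add, hbc, h1, h2]
        · cases h3 : add l' l'' <;> cases h4 : add r' r'' <;> by_cases hbc : b = c <;>
            simp [add, hab, hbc, h3, h4]
          all_goals simp_all

theorem addOpt_assoc [DecidableEq Γ] {h : ℕ} (x y z : Option (PTree Γ h)) :
    addOpt (addOpt x y) z = addOpt x (addOpt y z) := by
  cases x <;> cases y <;> cases z <;> simp [addOpt]
  exact add_assoc _ _ _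

/-- The sum does not depend on the order of the summands. -/
theorem sum_perm [DecidableEq Γ] {h : ℕ} {xs ys : List (Option (PTree Γ h))}
    (hp : xs.Perm ys) : sum xs = sum ys := by
  have key : ∀ (x : Option (PTree Γ h)) (l : List (Option (PTree Γ h))),
      sum (x :: l) = if l = [] then x else addOpt x (sum l) := by
    intro x l
    cases l <;> simp [sum]
  induction hp with
  | nil => rfl
  | @cons x l₁ l₂ hp ih =>
    rw [key, key, ih]
    have : l₁ = [] ↔ l₂ = [] := by
      rw [← List.length_eq_zero_iff, ← List.length_eq_zero_iff, hp.length_eq]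
    simp [this]
  | swap x y l =>
    rw [key, key, key, key]
    by_cases hl : l = []
    · simp [hl, addOpt_comm]
    · simp only [hl, reduceCtorEq, if_false]
      rw [← addOpt_assoc, ← addOpt_assoc, addOpt_comm y x]
  | trans _ _ ih1 ih2 => exact ih1.trans ih2

end PTree

/-! ### Synchronized weighted tree automata -/

/-- A linear form over `Q`: a non-empty partial map from `Q` to the weights `K`. A state with
coefficient `0` is distinguished from a state that does not occur. -/
structure LinForm (K Q : Type*) where
  coeff : Q → Option K
  nonempty : ∃ q, (coeff q).isSome

namespace LinForm

variable {K L Q Γ : Type*}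

/-- The states that occur in a linear form. -/
def supp [Fintype Q] (v : LinForm K Q) : Finset Q :=
  Finset.univ.filter fun q => (v.coeff q).isSome

/-- Apply a function to all coefficients. -/
def map (φ : K → L) (v : LinForm K Q) : LinForm L Q where
  coeff q := (v.coeff q).map φ
  nonempty := by
    obtain ⟨q, hq⟩ := v.nonempty
    exact ⟨q, by simpa using hq⟩

/-- The sum of `v[q] · ν q` over all `q` in the support of `v`; it is undefined if `ν q` is
undefined for some `q` in the support, even if `v[q] = 0`. -/
noncomputable def eval [Fintype Q] [DecidableEq Γ] {h : ℕ} (v : LinForm ℂ Q)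
    (ν : Q → Option (PTree Γ h)) : Option (PTree Γ h) :=
  PTree.sum <| v.supp.toList.map fun q =>
    (v.coeff q).bind fun c => (ν q).map fun t => PTree.scale c t

end LinForm

/-- A synchronized weighted tree automaton over the alphabet `Γ` with set of states `Q`, set of
colors `C` and weights in `K`. -/
structure SWTA (K Γ Q C : Type*) where
  root : Q
  leaves : Finset Q
  δ : Q → Γ → C → Option (LinForm K Q × LinForm K Q)

namespace SWTA

variable {K L Γ Q C : Type*}

/-- Apply a function to all weights. -/
def map (φ : K → L) (A : SWTA K Γ Q C) : SWTA L Γ Q C where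
  root := A.root
  leaves := A.leaves
  δ q a c := (A.δ q a c).map fun p => (p.1.map φ, p.2.map φ)

/-- The (partial) tree function of a state. A word of length `h` yields a tree of height `h`. -/
noncomputable def treeFun [Fintype Q] [DecidableEq Q] [DecidableEq Γ]
    (A : SWTA ℂ Γ Q C) :
    (w : List (Γ × C)) → Q → Option (PTree Γ w.length)
  | [], q => if q ∈ A.leaves then some (PTree.leaf 1) else none
  | (a, c) :: u, q =>
      (A.δ q a c).bind fun p =>
        (p.1.eval (treeFun A u)).bind fun l =>
          (p.2.eval (treeFun A u)).map fun r => PTree.node a l r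

/-- The language: all trees (of any height) that the tree function of the root state yields on
some word. -/
def language [Fintype Q] [DecidableEq Q] [DecidableEq Γ] (A : SWTA ℂ Γ Q C) :
    Set (Σ h, PTree Γ h) :=
  {t | ∃ w : List (Γ × C), ∃ s, A.treeFun w A.root = some s ∧ t = ⟨w.length, s⟩}

end SWTA

/-! ### Finite representations -/

/-- Names for algebraic complex numbers: the tuple `(a₀, …, aₘ₋₁, k)`. -/
abbrev AlgNum (m : ℕ) : Type := (Fin m → ℤ) × ℕ

/-- The number named by `(a₀, …, aₘ₋₁, k)` is `(a₀ + a₁ ω + … + aₘ₋₁ ω ^ (m - 1)) / √(2 ^ k)`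
with `ω = exp (i π / m)`. -/
noncomputable def AlgNum.val {m : ℕ} (z : AlgNum m) : ℂ :=
  (1 / (Real.sqrt ((2 : ℝ) ^ z.2) : ℂ)) *
    ∑ j : Fin m, (z.1 j : ℂ) * Complex.exp (Complex.I * Real.pi / m) ^ (j : ℕ)

/-- A finitely given automaton: finitely many states and colors (numbered from `0`), at least one
color, the alphabet `Fin k`, and weights given by their names. -/
structure FinSWTA (k m : ℕ) where
  numStates : ℕ
  numColors : ℕ
  numColors_pos : 0 < numColors
  aut : SWTA (AlgNum m) (Fin k) (Fin numStates) (Fin numColors)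

/-- Codes of linear forms: the table of the coefficients. -/
abbrev FormCode (m : ℕ) : Type := List (Option (AlgNum m))

/-- Codes of automata: the number of states, the number of colors, the root state, the list of
bits that tell which states are leaf states, and the transition table, indexed by state, symbol
and color. -/
abbrev SWTACode (m : ℕ) : Type :=
  ℕ × ℕ × ℕ × List Bool × List (List (List (Option (FormCode m × FormCode m))))

namespace FinSWTA

variable {k m : ℕ}

/-- The language of the automaton with the complex weights that the names stand for. -/
def language (A : FinSWTA k m) : Set (Σ h, PTree (Fin k) h) :=
  (A.aut.map AlgNum.val).language

/-- The code of an automaton, as input for an algorithm. -/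
def encode (A : FinSWTA k m) : SWTACode m :=
  (A.numStates, A.numColors, A.aut.root,
    List.ofFn fun q => decide (q ∈ A.aut.leaves),
    List.ofFn fun q => List.ofFn fun a => List.ofFn fun c =>
      (A.aut.δ q a c).map fun p => (List.ofFn p.1.coeff, List.ofFn p.2.coeff))

end FinSWTA

/-!
The halting problem is reduced to the disjointness problem, with integer weights, ignored labels
and a fixed second automaton.

If all non-root states of an automaton are leaf states and occur in all linear forms, then the leaf
at the end of a branch is a product of integer matrices, one for each color and direction, applied
to the all-ones vector (`intSWTA_treeFun`). The second automaton yields exactly the trees of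
positive height whose leaves are all `0`. So the languages meet iff some non-empty color word makes
this product vanish for *all* sequences of directions (`language_inter_zeroAut`): a color word is
guessed, and each branch may check one linear equation about it.

This is enough to check the runs of a system of affine rules on pairs of natural numbers, in which
rule `r` takes `a y + b` to `c y + e` in each coordinate, for any natural number `y`. A run is
written as a sequence of blocks, each a rule followed by its parameters `y` in unary. The numbers
`a y + b` and `c y + e` of a block are linear in the numbers of ticks, so the equations saying that
the result of one rule is the argument of the next are linear; a branch selects the equation by its
directions (`AffineRules.exists_forall_branchValue_iff_accepts`).

A Turing machine is such a system (`Turing.TM0.accepts_iff_eval_dom`): the two halves of the tape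
are numbers in base `B`, and pushing or popping a digit is an affine relation between the old and
the new number. Mathlib's compilation of partial recursive functions yields one machine whose
halting problem is undecidable (`exists_universal_machine`). Its input enters the automaton only
through the initial pair, which occurs in the weights of a single state, so the reduction is
computable (`computable_encode_intAut`, `AffineRules.computable_weight`).
-/

/-! ### Trees given by branch functions -/

namespace PTree

variable {Γ C : Type*}

/-- The perfect tree over a word `w` of labels and colors: all nodes at one depth carry the same
label, and the leaf at the end of a branch is the value of `f` at the word that pairs each color
with the direction taken at this depth (`false` for left, `true` for right). -/
def ofBranches : (w : List (Γ × C)) → (List (C × Bool) → ℂ) → PTree Γ w.length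
  | [], f => leaf (f [])
  | (a, c) :: w, f =>
      node a (ofBranches w fun u => f ((c, false) :: u)) (ofBranches w fun u => f ((c, true) :: u))

theorem scale_ofBranches (z : ℂ) (w : List (Γ × C)) (f : List (C × Bool) → ℂ) :
    scale z (ofBranches w f) = ofBranches w fun u => z * f u := by
  induction w generalizing f with
  | nil => rfl
  | cons x w ih => obtain ⟨a, c⟩ := x; simp [ofBranches, scale, ih]

theorem add_ofBranches [DecidableEq Γ] (w : List (Γ × C)) (f g : List (C × Bool) → ℂ) :
    add (ofBranches w f) (ofBranches w g) = some (ofBranches w fun u => f u + g u) := by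
  induction w generalizing f g with
  | nil => rfl
  | cons x w ih => obtain ⟨a, c⟩ := x; simp [ofBranches, add, ih]

theorem sum_ofBranches [DecidableEq Γ] {ι : Type*} (w : List (Γ × C)) (l : List ι) (hl : l ≠ [])
    (f : ι → List (C × Bool) → ℂ) :
    sum (l.map fun i => some (ofBranches w (f i))) =
      some (ofBranches w fun u => (l.map fun i => f i u).sum) := by
  induction l with
  | nil => exact absurd rfl hl
  | cons i l ih =>
    cases l with
    | nil => simp [sum]
    | cons j l =>
      have h := ih (by simp)
      simp only [List.map_cons] at h ⊢
      rw [sum, h]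
      simp [addOpt, add_ofBranches]

/-- All leaves of the tree are `0`. -/
def AllZero : {h : ℕ} → PTree Γ h → Prop
  | _, leaf z => z = 0
  | _, node _ l r => AllZero l ∧ AllZero r

theorem allZero_ofBranches (w : List (Γ × C)) (f : List (C × Bool) → ℂ) :
    AllZero (ofBranches w f) ↔
      ∀ u : List (C × Bool), u.map Prod.fst = w.map Prod.snd → f u = 0 := by
  induction w generalizing f with
  | nil => simp [ofBranches, AllZero]
  | cons x w ih =>
    obtain ⟨a, c⟩ := x
    simp only [ofBranches, AllZero, ih]
    constructor
    · rintro ⟨h1, h2⟩ u hu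
      obtain _ | ⟨⟨c', b⟩, u⟩ := u
      · simp at hu
      · simp only [List.map_cons, List.cons.injEq] at hu
        obtain ⟨rfl, hu⟩ := hu
        cases b
        · exact h1 u hu
        · exact h2 u hu
    · intro h
      exact ⟨fun u hu => h _ (by simp [hu]), fun u hu => h _ (by simp [hu])⟩

/-- The tree with all labels `a` and all leaves `0`. -/
def zeroTree (a : Γ) : (h : ℕ) → PTree Γ h
  | 0 => leaf 0
  | h + 1 => node a (zeroTree a h) (zeroTree a h)

theorem ofBranches_eq_zeroTree (a : Γ) (w : List (Γ × C)) (f : List (C × Bool) → ℂ)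
    (hw : ∀ x ∈ w, x.1 = a) (hf : AllZero (ofBranches w f)) :
    ofBranches w f = zeroTree a w.length := by
  induction w generalizing f with
  | nil => simpa [ofBranches, AllZero, zeroTree] using hf
  | cons x w ih =>
    obtain ⟨a', c⟩ := x
    obtain rfl : a' = a := hw (a', c) (by simp)
    have hw' : ∀ x ∈ w, x.1 = a' := fun x hx => hw x (by simp [hx])
    simp only [ofBranches, List.length_cons, zeroTree]
    rw [ih _ hw' hf.1, ih _ hw' hf.2]

theorem sigma_zeroTree (a : Γ) {h h' : ℕ} (e : h = h') :
    (⟨h, zeroTree a h⟩ : Σ h, PTree Γ h) = ⟨h', zeroTree a h'⟩ := by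
  subst e; rfl

end PTree

/-! ### Automata with integer weights -/

/-- The name of an integer, as an algebraic number. -/
def intNum (m : ℕ) (z : ℤ) : AlgNum m := (fun j => if (j : ℕ) = 0 then z else 0, 0)

theorem intNum_val {m : ℕ} (hm : 0 < m) (z : ℤ) : (intNum m z).val = z := by
  obtain ⟨m, rfl⟩ : ∃ m', m = m' + 1 := ⟨m - 1, by omega⟩
  simp [AlgNum.val, intNum]

section IntegerAutomata

variable {S C : Type*} [Fintype S]

/-- The linear form with integer coefficients `v` on the states of `S`, in the numbering of
`Option S`. The state `none` does not occur in it. -/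
noncomputable def intForm (m : ℕ) [Nonempty S] (v : S → ℤ) :
    LinForm (AlgNum m) (Fin (Fintype.card (Option S))) where
  coeff q := ((Fintype.equivFin (Option S)).symm q).map fun s => intNum m (v s)
  nonempty := ⟨Fintype.equivFin (Option S) (some (Classical.arbitrary S)), by simp⟩

/-- The automaton with states `Option S`, colors `C` and integer weights `W q c b s`, where `b`
tells the left (`false`) from the right (`true`) linear form. Labels are ignored. The root `none`
occurs in no linear form, and exactly the other states are leaf states. -/
noncomputable def intSWTA (k m : ℕ) [Nonempty S] [Fintype C] (W : Option S → C → Bool → S → ℤ) :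
    SWTA (AlgNum m) (Fin k) (Fin (Fintype.card (Option S))) (Fin (Fintype.card C)) where
  root := Fintype.equivFin (Option S) none
  leaves := Finset.univ.filter fun q => ((Fintype.equivFin (Option S)).symm q).isSome
  δ q _ c :=
    some (intForm m (W ((Fintype.equivFin (Option S)).symm q) ((Fintype.equivFin C).symm c) false),
      intForm m (W ((Fintype.equivFin (Option S)).symm q) ((Fintype.equivFin C).symm c) true))

/-- `intSWTA` as a finitely given automaton. -/
noncomputable def intAut (k m : ℕ) [Nonempty S] [Fintype C] [Nonempty C]
    (W : Option S → C → Bool → S → ℤ) : FinSWTA k m where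
  numStates := Fintype.card (Option S)
  numColors := Fintype.card C
  numColors_pos := Fintype.card_pos
  aut := intSWTA k m W

theorem intAut_language (k m : ℕ) [Nonempty S] [Fintype C] [Nonempty C]
    (W : Option S → C → Bool → S → ℤ) :
    (intAut k m W).language = ((intSWTA k m W).map AlgNum.val).language := rfl

open scoped Matrix in
/-- The leaf that a state yields at the end of a branch, given by colors and directions: a product
of weight matrices, applied to the all-ones vector. -/
def branchValue (W : Option S → C → Bool → S → ℤ) : List (C × Bool) → Option S → ℤ
  | [], _ => 1
  | (c, b) :: u, q => W q c b ⬝ᵥ fun s => branchValue W u (some s)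

variable [Nonempty S]

theorem intForm_supp (m : ℕ) (v : S → ℤ) :
    ((intForm m v).map AlgNum.val).supp =
      Finset.univ.map
        (Function.Embedding.some.trans (Fintype.equivFin (Option S)).toEmbedding) := by
  ext q
  obtain ⟨o, rfl⟩ := (Fintype.equivFin (Option S)).surjective q
  cases o <;> simp [LinForm.supp, LinForm.map, intForm]

theorem intForm_eval {Γ D : Type*} [DecidableEq Γ] {m : ℕ} (hm : 0 < m) (v : S → ℤ)
    (w : List (Γ × D)) (g : S → List (D × Bool) → ℂ)
    (ν : Fin (Fintype.card (Option S)) → Option (PTree Γ w.length))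
    (hν : ∀ s, ν (Fintype.equivFin (Option S) (some s)) = some (PTree.ofBranches w (g s))) :
    ((intForm m v).map AlgNum.val).eval ν =
      some (PTree.ofBranches w fun u => ∑ s, (v s : ℂ) * g s u) := by
  have hperm : ((intForm m v).map AlgNum.val).supp.toList.Perm
      ((Finset.univ : Finset S).toList.map fun s => Fintype.equivFin (Option S) (some s)) := by
    refine (List.perm_ext_iff_of_nodup (Finset.nodup_toList _) ?_).2 ?_
    · refine (Finset.nodup_toList _).map ?_
      intro s t h
      simpa using h
    · intro q
      simp [intForm_supp]
  rw [LinForm.eval, PTree.sum_perm (hperm.map _), List.map_map]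
  have h := PTree.sum_ofBranches w (Finset.univ : Finset S).toList
    (by simp [Finset.univ_eq_empty_iff])
    (fun s u => (v s : ℂ) * g s u)
  simp only [Finset.sum_map_toList] at h
  rw [← h]
  congr 1
  refine List.map_congr_left fun s _ => ?_
  simp [hν, LinForm.map, intForm, intNum_val hm, PTree.scale_ofBranches]

variable [Fintype C]

theorem intSWTA_treeFun {k m : ℕ} (hm : 0 < m) (W : Option S → C → Bool → S → ℤ)
    (w : List (Fin k × Fin (Fintype.card C))) (q : Option S) (hq : w = [] → q.isSome) :
    ((intSWTA k m W).map AlgNum.val).treeFun w (Fintype.equivFin (Option S) q) =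
      some (PTree.ofBranches w fun u =>
        (branchValue W (u.map fun x => ((Fintype.equivFin C).symm x.1, x.2)) q : ℂ)) := by
  induction w generalizing q with
  | nil =>
    have hmem : Fintype.equivFin (Option S) q ∈ ((intSWTA k m W).map AlgNum.val).leaves := by
      simpa [SWTA.map, intSWTA] using hq rfl
    simp [SWTA.treeFun, hmem, PTree.ofBranches, branchValue]
  | cons x w ih =>
    obtain ⟨a, c⟩ := x
    have h := fun s => ih (some s) (by simp)
    simp only [SWTA.treeFun]
    rw [show ((intSWTA k m W).map AlgNum.val).δ (Fintype.equivFin (Option S) q) a c =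
      some ((intForm m (W q ((Fintype.equivFin C).symm c) false)).map AlgNum.val,
        (intForm m (W q ((Fintype.equivFin C).symm c) true)).map AlgNum.val) by
      simp [SWTA.map, intSWTA]]
    simp only [Option.bind_some]
    rw [intForm_eval hm _ w _ _ h, intForm_eval hm _ w _ _ h]
    simp [PTree.ofBranches, branchValue, dotProduct]

/-- The automaton whose trees of positive height have all leaves `0`. -/
noncomputable def zeroAut (k m : ℕ) : FinSWTA k m :=
  intAut (S := Unit) (C := Unit) k m 0

theorem branchValue_zero {S C : Type*} [Fintype S] (u : List (C × Bool)) (hu : u ≠ [])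
    (q : Option S) : branchValue (0 : Option S → C → Bool → S → ℤ) u q = 0 := by
  cases u with
  | nil => exact absurd rfl hu
  | cons x u => simp [branchValue]

theorem intSWTA_treeFun_nil {k m : ℕ} (W : Option S → C → Bool → S → ℤ) :
    ((intSWTA k m W).map AlgNum.val).treeFun [] (intSWTA k m W).root = none := by
  simp [SWTA.treeFun, SWTA.map, intSWTA]

/-- The languages of an automaton with integer weights and of the zero automaton meet iff some
non-empty color word makes all branch values of the root vanish. -/
theorem language_inter_zeroAut [Nonempty C] {k m : ℕ} (hk : 0 < k) (hm : 0 < m)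
    (W : Option S → C → Bool → S → ℤ) :
    ((intAut k m W).language ∩ (zeroAut k m).language).Nonempty ↔
      ∃ cs : List C, cs ≠ [] ∧
        ∀ u : List (C × Bool), u.map Prod.fst = cs → branchValue W u none = 0 := by
  have hroot : ∀ w : List (Fin k × Fin (Fintype.card C)), w ≠ [] → _ :=
    fun w hw => intSWTA_treeFun hm W w none (fun h => absurd h hw)
  have hroot0 : ∀ w : List (Fin k × Fin (Fintype.card Unit)), w ≠ [] → _ :=
    fun w hw => intSWTA_treeFun hm (0 : Option Unit → Unit → Bool → Unit → ℤ) w none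
      (fun h => absurd h hw)
  have hzero : ∀ w : List (Fin k × Fin (Fintype.card Unit)), w ≠ [] →
      PTree.AllZero (PTree.ofBranches w fun u =>
        (branchValue (0 : Option Unit → Unit → Bool → Unit → ℤ)
          (u.map fun x => ((Fintype.equivFin Unit).symm x.1, x.2)) none : ℂ)) := by
    intro w hw
    rw [PTree.allZero_ofBranches]
    intro u hu
    rw [branchValue_zero, Int.cast_zero]
    rintro h
    apply hw
    have h' := congrArg List.length h
    have hu' := congrArg List.length hu
    simp only [List.length_map, List.length_nil] at h' hu'
    exact List.length_eq_zero_iff.1 (hu'.symm.trans h')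
  rw [zeroAut, intAut_language, intAut_language]
  constructor
  · rintro ⟨t, ⟨w, s, hs, rfl⟩, ⟨w', s', hs', e⟩⟩
    have hw : w ≠ [] := by
      rintro rfl
      exact absurd (hs.symm.trans (intSWTA_treeFun_nil W)) (by simp)
    have hw' : w' ≠ [] := by
      rintro rfl
      exact absurd (hs'.symm.trans
        (intSWTA_treeFun_nil (0 : Option Unit → Unit → Bool → Unit → ℤ))) (by simp)
    obtain rfl := Option.some.inj (hs'.symm.trans (hroot0 w' hw'))
    obtain rfl := Option.some.inj (hs.symm.trans (hroot w hw))
    have key : ∀ t t' : Σ h, PTree (Fin k) h, t = t' → t'.2.AllZero → t.2.AllZero := by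
      rintro t t' rfl h; exact h
    have hz := key _ _ e (hzero w' hw')
    replace hz := (PTree.allZero_ofBranches _ _).1 hz
    refine ⟨w.map fun x => (Fintype.equivFin C).symm x.2, by simpa using hw, fun u hu => ?_⟩
    have := hz (u.map fun x => (Fintype.equivFin C x.1, x.2)) (by
      have := congrArg (List.map (Fintype.equivFin C)) hu
      simpa [Function.comp_def] using this)
    simpa [Function.comp_def] using this
  · rintro ⟨cs, hcs, h⟩
    let a : Fin k := ⟨0, hk⟩
    let w : List (Fin k × Fin (Fintype.card C)) := cs.map fun c => (a, Fintype.equivFin C c)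
    let w' : List (Fin k × Fin (Fintype.card Unit)) :=
      cs.map fun _ => (a, Fintype.equivFin Unit ())
    have hw : w ≠ [] := by simpa [w] using hcs
    have hw' : w' ≠ [] := by simpa [w'] using hcs
    have hlab : ∀ x ∈ w, x.1 = a := by
      intro x hx
      obtain ⟨_, _, rfl⟩ := List.mem_map.1 hx
      rfl
    have hlab' : ∀ x ∈ w', x.1 = a := by
      intro x hx
      obtain ⟨_, _, rfl⟩ := List.mem_map.1 hx
      rfl
    have hz : PTree.AllZero (PTree.ofBranches w fun u =>
        (branchValue W (u.map fun x => ((Fintype.equivFin C).symm x.1, x.2)) none : ℂ)) := by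
      rw [PTree.allZero_ofBranches]
      intro u hu
      rw [h, Int.cast_zero]
      have := congrArg (List.map (Fintype.equivFin C).symm) hu
      simpa [w, Function.comp_def] using this
    refine ⟨⟨w.length, PTree.zeroTree a w.length⟩, ⟨w, _, hroot w hw, ?_⟩,
      ⟨w', _, hroot0 w' hw', ?_⟩⟩
    · rw [PTree.ofBranches_eq_zeroTree a w _ hlab hz]
    · rw [PTree.ofBranches_eq_zeroTree a w' _ hlab' (hzero w' hw')]
      exact PTree.sigma_zeroTree a ((List.length_map _).trans (List.length_map _).symm)

end IntegerAutomata

/-! ### Affine rule systems -/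

/-- A family of rules on pairs of natural numbers, indexed by `Bool`. Rule `r` takes every pair of
the form `x j = inMul r j * y j + inAdd r j` to the pair `outMul r j * y j + outAdd r j`. -/
structure AffineRules (R : Type*) where
  inMul : R → Bool → ℕ
  inAdd : R → Bool → ℕ
  outMul : R → Bool → ℕ
  outAdd : R → Bool → ℕ

namespace AffineRules

variable {R : Type*} (P : AffineRules R)

/-- One application of a rule. -/
def Step (x x' : Bool → ℕ) : Prop :=
  ∃ (r : R) (y : Bool → ℕ), ∀ j,
    x j = P.inMul r j * y j + P.inAdd r j ∧ x' j = P.outMul r j * y j + P.outAdd r j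

/-- The pair `(1, 1)` is reachable from `x`. -/
def Accepts (x : Bool → ℕ) : Prop := Relation.ReflTransGen P.Step x fun _ => 1

/-! ### Histories of rule applications as color words -/

/-- The colors are the rules (`Sum.inl r`), and a tick for each coordinate (`Sum.inr j`). A history
of rule applications is written as a sequence of blocks, each a rule followed by ticks that give
the parameters `y` in unary. This is the number of ticks for `j` before the first rule. -/
def ticks (j : Bool) : List (R ⊕ Bool) → ℕ
  | [] => 0
  | Sum.inl _ :: _ => 0
  | Sum.inr i :: cs => ticks j cs + if j = i then 1 else 0

/-- Coordinate `j` of the pair to which the first rule of the word is applied, or `1` if there is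
no rule left. -/
def input (j : Bool) : List (R ⊕ Bool) → ℕ
  | [] => 1
  | Sum.inl r :: cs => P.inMul r j * ticks j cs + P.inAdd r j
  | Sum.inr _ :: cs => input j cs

/-- Each rule of the word yields the pair to which the next one is applied. -/
def Chained : List (R ⊕ Bool) → Prop
  | [] => True
  | Sum.inl r :: cs =>
      (∀ j, P.outMul r j * ticks j cs + P.outAdd r j = P.input j cs) ∧ Chained cs
  | Sum.inr _ :: cs => Chained cs

theorem Chained.accepts {cs : List (R ⊕ Bool)} (h : P.Chained cs) :
    P.Accepts fun j => P.input j cs := by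
  induction cs with
  | nil => exact .refl
  | cons c cs ih =>
    rcases c with r | i
    · exact .head ⟨r, fun j => ticks j cs, fun j => ⟨rfl, (h.1 j).symm⟩⟩ (ih h.2)
    · exact ih h

/-- Putting ticks in front of a word raises one tick count and changes nothing else. -/
theorem exists_ticks (n : ℕ) (i : Bool) (cs : List (R ⊕ Bool)) (h : P.Chained cs) :
    ∃ cs', P.Chained cs' ∧ (∀ j, P.input j cs' = P.input j cs) ∧
      ∀ j, ticks j cs' = ticks j cs + if j = i then n else 0 := by
  induction n with
  | zero => exact ⟨cs, h, fun _ => rfl, by simp⟩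
  | succ n ih =>
    obtain ⟨cs', h1, h2, h3⟩ := ih
    refine ⟨Sum.inr i :: cs', h1, h2, fun j => ?_⟩
    simp only [ticks, h3]
    split_ifs <;> omega

theorem Accepts.exists_chained {x : Bool → ℕ} (h : P.Accepts x) :
    ∃ cs, P.Chained cs ∧ (∀ j, P.input j cs = x j) ∧ ∀ j, ticks j cs = 0 := by
  induction h using Relation.ReflTransGen.head_induction_on with
  | refl => exact ⟨[], trivial, fun _ => rfl, fun _ => rfl⟩
  | head hs _ ih =>
    obtain ⟨r, y, hy⟩ := hs
    obtain ⟨cs, h1, h2, h3⟩ := ih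
    obtain ⟨cs', h1', h2', h3'⟩ := P.exists_ticks (y true) true cs h1
    obtain ⟨cs'', h1'', h2'', h3''⟩ := P.exists_ticks (y false) false cs' h1'
    have ht : ∀ j, ticks j cs'' = y j := by
      intro j
      rw [h3'', h3', h3]
      cases j <;> simp
    refine ⟨Sum.inl r :: cs'', ⟨fun j => ?_, h1''⟩, fun j => ?_, fun j => rfl⟩
    · rw [ht, h2'', h2', h2, (hy j).2]
    · rw [input, ht, (hy j).1]

/-! ### The automaton that checks histories -/

/-- The states besides the root. Read from the right, a color word updates `ticks j` and `input j`
as registers; `chain j` yields the discrepancy, in coordinate `j`, between the result of one rule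
and the argument of the next, where the branch selects the rule. -/
inductive Reg
  | one
  | ticks (j : Bool)
  | input (j : Bool)
  | chain (j : Bool)
  | chains
  | start
  deriving DecidableEq, Fintype

instance : Nonempty Reg := ⟨Reg.one⟩

/-- The weights. As all these states yield `1` on the empty word, the registers `ticks` and `chain`
are stored with `1` added. The first two directions of a branch select a coordinate and whether
the chaining of the rules or the start of the history at `x` is to be checked. -/
def weight (x : Bool → ℕ) : Option Reg → R ⊕ Bool → Bool → Reg → ℤ
  | none, _, b => Pi.single (if b then Reg.start else Reg.chains) 1
  | some .chains, _, b => Pi.single (.chain b) 1 - Pi.single .one 1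
  | some .start, _, b => Pi.single .one (x b : ℤ) - Pi.single (.input b) 1
  | some .one, _, _ => Pi.single .one 1
  | some (.ticks _), Sum.inl _, _ => Pi.single .one 1
  | some (.ticks j), Sum.inr i, _ =>
      Pi.single (.ticks j) 1 + Pi.single .one (if j = i then 1 else 0)
  | some (.input j), Sum.inl r, _ =>
      Pi.single (.ticks j) (P.inMul r j : ℤ) + Pi.single .one ((P.inAdd r j : ℤ) - P.inMul r j)
  | some (.input j), Sum.inr _, _ => Pi.single (.input j) 1
  | some (.chain j), Sum.inl _, false => Pi.single (.chain j) 1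
  | some (.chain j), Sum.inl r, true =>
      Pi.single (.ticks j) (P.outMul r j : ℤ) +
        Pi.single .one ((P.outAdd r j : ℤ) - P.outMul r j + 1) - Pi.single (.input j) 1
  | some (.chain j), Sum.inr _, _ => Pi.single (.chain j) 1

theorem branchValue_one (x : Bool → ℕ) (u : List ((R ⊕ Bool) × Bool)) :
    branchValue (P.weight x) u (some .one) = 1 := by
  induction u with
  | nil => rfl
  | cons a u ih => obtain ⟨c, b⟩ := a; simp [branchValue, weight, ih]

theorem branchValue_ticks (x : Bool → ℕ) (u : List ((R ⊕ Bool) × Bool)) (j : Bool) :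
    branchValue (P.weight x) u (some (.ticks j)) = ticks j (u.map Prod.fst) + 1 := by
  induction u with
  | nil => rfl
  | cons a u ih =>
    obtain ⟨c | i, b⟩ := a
    · simp [branchValue, weight, branchValue_one, ticks]
    · simp only [branchValue, weight, add_dotProduct, single_dotProduct, ih, branchValue_one,
        List.map_cons, ticks]
      push_cast
      split_ifs <;> ring

theorem branchValue_input (x : Bool → ℕ) (u : List ((R ⊕ Bool) × Bool)) (j : Bool) :
    branchValue (P.weight x) u (some (.input j)) = P.input j (u.map Prod.fst) := by
  induction u with
  | nil => rfl
  | cons a u ih =>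
    obtain ⟨r | i, b⟩ := a
    · simp only [branchValue, weight, add_dotProduct, single_dotProduct, branchValue_ticks,
        branchValue_one, List.map_cons, input]
      push_cast
      ring
    · simp [branchValue, weight, ih, input]

theorem forall_branchValue_chain (x : Bool → ℕ) (cs : List (R ⊕ Bool)) :
    (∀ u : List ((R ⊕ Bool) × Bool), u.map Prod.fst = cs →
      ∀ j, branchValue (P.weight x) u (some (.chain j)) = 1) ↔ P.Chained cs := by
  have hdir : ∀ cs : List (R ⊕ Bool), ∃ u : List ((R ⊕ Bool) × Bool), u.map Prod.fst = cs :=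
    fun cs => ⟨cs.map fun c => (c, false), by simp [Function.comp_def]⟩
  induction cs with
  | nil => simp [Chained, branchValue]
  | cons c cs ih =>
    have hcons : ∀ q : List ((R ⊕ Bool) × Bool) → Prop,
        (∀ u, u.map Prod.fst = c :: cs → q u) ↔
          ∀ b u, u.map Prod.fst = cs → q ((c, b) :: u) := by
      intro q
      constructor
      · exact fun h b u hu => h _ (by simp [hu])
      · rintro h (_ | ⟨⟨c', b⟩, u⟩) hu
        · simp at hu
        · simp only [List.map_cons, List.cons.injEq] at hu
          obtain ⟨rfl, hu⟩ := hu
          exact h b u hu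
    rw [hcons]
    rcases c with r | i
    · have htrue : ∀ u : List ((R ⊕ Bool) × Bool), u.map Prod.fst = cs → ∀ j,
          branchValue (P.weight x) ((Sum.inl r, true) :: u) (some (.chain j)) =
            ((P.outMul r j * ticks j cs + P.outAdd r j : ℕ) : ℤ) - P.input j cs + 1 := by
        rintro u rfl j
        simp only [branchValue, weight, add_dotProduct, sub_dotProduct, single_dotProduct,
          branchValue_ticks, branchValue_one, branchValue_input]
        push_cast
        ring
      rw [Chained]
      constructor
      · intro h
        refine ⟨fun j => ?_, ih.1 fun u hu j => ?_⟩
        · obtain ⟨u, hu⟩ := hdir cs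
          have := h true u hu j
          rw [htrue u hu] at this
          omega
        · simpa [branchValue, weight] using h false u hu j
      · rintro ⟨h1, h2⟩ b u hu j
        cases b
        · simpa [branchValue, weight] using ih.2 h2 u hu j
        · rw [htrue u hu, h1]
          ring
    · rw [Chained]
      constructor
      · refine fun h => ih.1 fun u hu j => ?_
        simpa [branchValue, weight] using h false u hu j
      · intro h b u hu j
        simpa [branchValue, weight] using ih.2 h u hu j

/-- All branch values of the root vanish on a color word iff it is a history from `x` to `(1, 1)`,
after two irrelevant colors. -/
theorem exists_forall_branchValue_iff_accepts (x : Bool → ℕ) :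
    (∃ cs : List (R ⊕ Bool), cs ≠ [] ∧
      ∀ u : List ((R ⊕ Bool) × Bool), u.map Prod.fst = cs →
        branchValue (P.weight x) u none = 0) ↔ P.Accepts x := by
  constructor
  · rintro ⟨cs, hcs, h⟩
    obtain _ | ⟨c, _ | ⟨c', cs⟩⟩ := cs
    · exact absurd rfl hcs
    · simpa [branchValue, weight] using h [(c, false)] rfl
    · have hchain : P.Chained cs := by
        rw [← P.forall_branchValue_chain x]
        intro u hu j
        have := h ((c, false) :: (c', j) :: u) (by simp [hu])
        simp only [branchValue, weight, sub_dotProduct, single_dotProduct, branchValue_one,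
          Bool.false_eq_true, if_false] at this
        linarith
      have hstart : (fun j => P.input j cs) = x := by
        funext j
        have := h ((c, true) :: (c', j) :: cs.map fun c => (c, false)) (by simp [Function.comp_def])
        simp only [branchValue, weight, sub_dotProduct, single_dotProduct, branchValue_one,
          branchValue_input, if_true, List.map_map, Function.comp_def, List.map_id'] at this
        omega
      rw [← hstart]
      exact hchain.accepts
  · intro h
    obtain ⟨cs, hchain, hstart, -⟩ := Accepts.exists_chained P h
    have c : R ⊕ Bool := Sum.inr true
    refine ⟨c :: c :: cs, by simp, fun u hu => ?_⟩
    obtain _ | ⟨⟨c1, b⟩, _ | ⟨⟨c2, j⟩, u⟩⟩ := u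
    · simp at hu
    · simp at hu
    · simp only [List.map_cons, List.cons.injEq] at hu
      obtain ⟨-, -, hu⟩ := hu
      have hone := (P.forall_branchValue_chain x cs).2 hchain u hu j
      cases b <;>
        simp [branchValue, weight, sub_dotProduct, branchValue_one, branchValue_input, hone, hu,
          hstart]

end AffineRules

/-! ### Simulation of Turing machines by affine rules -/

open Turing StateTransition

theorem Nat.mul_add_inj {K y y' e e' : ℕ} (he : e < K) (he' : e' < K)
    (h : K * y + e = K * y' + e') : y = y' ∧ e = e' := by
  have hK : 0 < K := by omega
  have h1 := congrArg (· / K) h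
  have h2 := congrArg (· % K) h
  simp only [Nat.mul_add_div hK, Nat.div_eq_of_lt he, Nat.div_eq_of_lt he', Nat.mul_add_mod,
    Nat.mod_eq_of_lt he, Nat.mod_eq_of_lt he'] at h1 h2
  exact ⟨by omega, h2⟩

/-- An injective coding of tape symbols by digits in base `B`, with digit `0` for the blank. -/
structure DigitCode (Γ : Type*) [Inhabited Γ] where
  B : ℕ
  sym : Γ → ℕ
  sym_injective : Function.Injective sym
  sym_lt : ∀ a, sym a < B
  sym_default : sym default = 0

namespace DigitCode

variable {Γ : Type*} [Inhabited Γ] (D : DigitCode Γ)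

instance [Fintype Γ] : Nonempty (DigitCode Γ) := by
  classical
  let e := Fintype.equivFin Γ
  refine ⟨⟨Fintype.card Γ + 1, fun a => if a = default then 0 else e a + 1, fun a b h => ?_,
    fun a => ?_, by simp⟩⟩
  · by_cases ha : a = default <;> by_cases hb : b = default <;> simp [ha, hb] at h ⊢
    exact e.injective (Fin.ext h)
  · split_ifs
    · omega
    · have := (e a).2
      omega

theorem B_pos : 0 < D.B := (Nat.zero_le _).trans_lt (D.sym_lt default)

/-- The base-`B` digits of `n`, least significant digit first, are the symbols of the half-infinite
tape `l`. -/
def Represents (l : ListBlank Γ) (n : ℕ) : Prop := ∀ i, n / D.B ^ i % D.B = D.sym (l.nth i)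

variable {D} {l : ListBlank Γ} {n : ℕ}

theorem Represents.cons (h : D.Represents l n) (a : Γ) :
    D.Represents (l.cons a) (D.B * n + D.sym a) := by
  intro i
  cases i with
  | zero => simp [Nat.mod_eq_of_lt (D.sym_lt a)]
  | succ i =>
    rw [ListBlank.nth_succ, ListBlank.tail_cons, ← h i, pow_succ', ← Nat.div_div_eq_div_mul,
      Nat.mul_add_div D.B_pos, Nat.div_eq_of_lt (D.sym_lt a), Nat.add_zero]

theorem Represents.tail (h : D.Represents l n) : D.Represents l.tail (n / D.B) := by
  intro i
  rw [← ListBlank.nth_succ, ← h (i + 1), pow_succ', Nat.div_div_eq_div_mul]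

theorem Represents.mod (h : D.Represents l n) : n % D.B = D.sym l.head := by
  simpa using h 0

theorem Represents.eq (h : D.Represents l n) : D.B * (n / D.B) + D.sym l.head = n := by
  rw [← h.mod, Nat.div_add_mod]

theorem Represents.of_eq {a : Γ} (h : D.Represents l (D.B * n + D.sym a)) :
    l.head = a ∧ D.Represents l.tail n := by
  have h1 := h.mod
  have h2 := h.tail
  rw [Nat.mul_add_mod, Nat.mod_eq_of_lt (D.sym_lt a)] at h1
  rw [Nat.mul_add_div D.B_pos, Nat.div_eq_of_lt (D.sym_lt a), Nat.add_zero] at h2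
  exact ⟨(D.sym_injective h1).symm, h2⟩

theorem represents_mk (D : DigitCode Γ) (l : List Γ) :
    D.Represents (ListBlank.mk l) (l.foldr (fun a n => D.B * n + D.sym a) 0) := by
  induction l with
  | nil =>
    intro i
    rw [ListBlank.nth_mk, List.getI_eq_default _ (by simp), D.sym_default]
    simp
  | cons a l ih => simpa [← ListBlank.cons_mk] using ih.cons a

end DigitCode

namespace Turing.TM0

variable {Γ Λ : Type*} [Inhabited Γ]

/-- The number of a state in a finite set of states, with a junk value outside of it. -/
noncomputable def stateCode (S : Finset Λ) (q : Λ) : ℕ :=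
  open scoped Classical in if h : q ∈ S then S.equivFin ⟨q, h⟩ else 0

/-- The code of the state and the scanned symbol; always at least `2`. -/
noncomputable def scanCode (D : DigitCode Γ) (S : Finset Λ) (q : Λ) (a : Γ) : ℕ :=
  D.B * stateCode S q + D.sym a + 2

/-- A strict upper bound for `scanCode`. -/
noncomputable def scanBound (D : DigitCode Γ) (S : Finset Λ) : ℕ := D.B * S.card + 2

variable {D : DigitCode Γ} {S : Finset Λ}

theorem scanCode_lt {q : Λ} (hq : q ∈ S) (a : Γ) : scanCode D S q a < scanBound D S := by
  have h1 := D.sym_lt a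
  have h2 : stateCode S q + 1 ≤ S.card := by
    rw [stateCode, dif_pos hq]
    exact (S.equivFin ⟨q, hq⟩).2
  have h3 := Nat.mul_le_mul_left D.B h2
  rw [Nat.mul_add] at h3
  rw [scanCode, scanBound]
  omega

theorem scanCode_inj {q q' : Λ} (hq : q ∈ S) (hq' : q' ∈ S) {a a' : Γ}
    (h : scanCode D S q a = scanCode D S q' a') : q = q' ∧ a = a' := by
  obtain ⟨h1, h2⟩ := Nat.mul_add_inj (D.sym_lt a) (D.sym_lt a') (Nat.add_right_cancel h)
  refine ⟨?_, D.sym_injective h2⟩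
  rw [stateCode, stateCode, dif_pos hq, dif_pos hq'] at h1
  simpa using S.equivFin.injective (Fin.ext h1)

variable [Inhabited Λ]

/-- The affine rules that simulate a Turing machine with states in `S`. A configuration is
represented by the pair of `scanBound * l + scanCode` and `r`, where the base-`B` digits of `l` and
`r` are the symbols left and right of the head. A rule is given by the state, the scanned symbol
and the symbol next to it that is scanned after a move. Halting configurations lead to `(1, 1)`,
which represents no configuration. -/
noncomputable def affineRules (M : Machine Γ Λ) (D : DigitCode Γ) (S : Finset Λ) :
    AffineRules (S × Γ × Γ) where
  inMul r j := match M r.1 r.2.1 with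
    | some (_, .move .left) => bif j then 1 else scanBound D S * D.B
    | some (_, .move .right) => bif j then D.B else scanBound D S
    | _ => bif j then 1 else scanBound D S
  inAdd r j := match M r.1 r.2.1 with
    | some (_, .move .left) =>
        bif j then 0 else scanBound D S * D.sym r.2.2 + scanCode D S r.1 r.2.1
    | some (_, .move .right) => bif j then D.sym r.2.2 else scanCode D S r.1 r.2.1
    | _ => bif j then 0 else scanCode D S r.1 r.2.1
  outMul r j := match M r.1 r.2.1 with
    | some (_, .move .left) => bif j then D.B else scanBound D S
    | some (_, .move .right) => bif j then 1 else scanBound D S * D.B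
    | some (_, .write _) => bif j then 1 else scanBound D S
    | none => 0
  outAdd r j := match M r.1 r.2.1 with
    | some (q, .move .left) => bif j then D.sym r.2.1 else scanCode D S q r.2.2
    | some (q, .move .right) =>
        bif j then 0 else scanBound D S * D.sym r.2.1 + scanCode D S q r.2.2
    | some (q, .write b) => bif j then 0 else scanCode D S q b
    | none => 1

/-- The pair `x` represents the configuration `c`. -/
def CfgRepresents (D : DigitCode Γ) (S : Finset Λ) (c : Cfg Γ Λ) (x : Bool → ℕ) : Prop :=
  c.q ∈ S ∧ (∃ l, D.Represents c.Tape.left l ∧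
    x false = scanBound D S * l + scanCode D S c.q c.Tape.head) ∧ D.Represents c.Tape.right (x true)

variable {M : Machine Γ Λ}

theorem exists_affine_step (hS : Supports M (S : Set Λ)) {c c' : Cfg Γ Λ} {x : Bool → ℕ}
    (hx : CfgRepresents D S c x) (hc : c' ∈ step M c) :
    ∃ x', (affineRules M D S).Step x x' ∧ CfgRepresents D S c' x' := by
  have hq' := step_supports M hS hc hx.1
  obtain ⟨q, T⟩ := c
  obtain ⟨hq, ⟨l, hl, hx0⟩, hr⟩ := hx
  dsimp only at hq hl hx0 hr
  obtain ⟨⟨q', s⟩, hM, rfl⟩ := Option.map_eq_some_iff.1 hc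
  rcases s with d | b
  · cases d
    · refine ⟨fun j => bif j then D.B * x true + D.sym T.head else
          scanBound D S * (l / D.B) + scanCode D S q' T.left.head,
        ⟨(⟨q, hq⟩, T.head, T.left.head), fun j => bif j then x true else l / D.B, fun j => ?_⟩,
        hq', ⟨l / D.B, hl.tail, rfl⟩, hr.cons T.head⟩
      cases j
      · refine ⟨?_, ?_⟩
        · simp only [affineRules, hM, cond_false]
          rw [hx0]
          conv_lhs => rw [← hl.eq]
          ring
        · simp only [affineRules, hM, cond_false]
      · simp [affineRules, hM]
    · refine ⟨fun j => bif j then x true / D.B else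
          scanBound D S * (D.B * l + D.sym T.head) + scanCode D S q' T.right.head,
        ⟨(⟨q, hq⟩, T.head, T.right.head), fun j => bif j then x true / D.B else l, fun j => ?_⟩,
        hq', ⟨_, hl.cons T.head, rfl⟩, hr.tail⟩
      cases j
      · refine ⟨?_, ?_⟩
        · simp only [affineRules, hM, cond_false, hx0]
        · simp only [affineRules, hM, cond_false]
          ring
      · refine ⟨?_, ?_⟩
        · simp only [affineRules, hM, cond_true]
          exact hr.eq.symm
        · simp [affineRules, hM]
  · refine ⟨fun j => bif j then x true else scanBound D S * l + scanCode D S q' b,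
      ⟨(⟨q, hq⟩, T.head, default), fun j => bif j then x true else l, fun j => ?_⟩,
      hq', ⟨l, hl, rfl⟩, hr⟩
    cases j <;> simp [affineRules, hM, hx0]

theorem affine_step_of_halt {c : Cfg Γ Λ} {x : Bool → ℕ} (hx : CfgRepresents D S c x)
    (hc : step M c = none) : (affineRules M D S).Step x fun _ => 1 := by
  obtain ⟨q, T⟩ := c
  obtain ⟨hq, ⟨l, hl, hx0⟩, hr⟩ := hx
  dsimp only at hq hl hx0 hr
  have hM : M q T.head = none := Option.map_eq_none_iff.1 hc
  refine ⟨(⟨q, hq⟩, T.head, default), fun j => bif j then x true else l, fun j => ?_⟩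
  cases j <;> simp [affineRules, hM, hx0]

/-- The only rule that applies to the representation of a configuration is the simulating one. -/
theorem cfgRepresents_of_affine_step (hS : Supports M (S : Set Λ)) {c : Cfg Γ Λ} {x x' : Bool → ℕ}
    (hx : CfgRepresents D S c x) (h : (affineRules M D S).Step x x') :
    step M c = none ∨ ∃ c' ∈ step M c, CfgRepresents D S c' x' := by
  rcases hc : step M c with _ | c'
  · exact Or.inl rfl
  refine Or.inr ⟨c', rfl, ?_⟩
  have hq' := step_supports M hS hc hx.1
  obtain ⟨q, T⟩ := c
  obtain ⟨hq, ⟨l, hl, hx0⟩, hr⟩ := hx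
  dsimp only at hq hl hx0 hr
  obtain ⟨⟨q', s⟩, hM, rfl⟩ := Option.map_eq_some_iff.1 hc
  obtain ⟨⟨⟨q₁, hq₁⟩, a, a'⟩, y, hy⟩ := h
  -- In each case the first coordinate is `scanBound * z + scanCode`.
  have hcode : ∀ z, scanBound D S * z + scanCode D S q₁ a = x false →
      z = l ∧ q₁ = q ∧ a = T.head := fun z hz => by
    obtain ⟨h1, h2⟩ := Nat.mul_add_inj (scanCode_lt hq₁ a) (scanCode_lt hq T.head) (hz.trans hx0)
    exact ⟨h1, scanCode_inj hq₁ hq h2⟩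
  have h0 := hy false
  have h1 := hy true
  have hqa : q₁ = q ∧ a = T.head := by
    rcases hM₁ : M q₁ a with _ | ⟨q₂, (_ | _) | b⟩ <;>
      simp only [affineRules, hM₁, cond_false] at h0
    · exact (hcode _ h0.1.symm).2
    · refine (hcode (D.B * y false + D.sym a') ?_).2
      rw [h0.1]
      ring
    · exact (hcode _ h0.1.symm).2
    · exact (hcode _ h0.1.symm).2
  obtain ⟨rfl, rfl⟩ := hqa
  rcases s with (_ | _) | b <;>
    simp only [affineRules, hM, cond_false, cond_true] at h0 h1
  · obtain ⟨hl', -⟩ := hcode (D.B * y false + D.sym a') (by rw [h0.1]; ring)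
    rw [← hl'] at hl
    obtain ⟨hhead, hl₂⟩ := hl.of_eq
    subst hhead
    refine ⟨hq', ⟨y false, hl₂, h0.2⟩, ?_⟩
    rw [h1.2]
    have : y true = x true := by simpa using h1.1.symm
    rw [this]
    exact hr.cons T.head
  · obtain ⟨rfl, -⟩ := hcode _ h0.1.symm
    rw [h1.1] at hr
    obtain ⟨hhead, hr₂⟩ := hr.of_eq
    subst hhead
    refine ⟨hq', ⟨_, hl.cons T.head, ?_⟩, ?_⟩
    · rw [h0.2]
      change _ = scanBound D S * _ + scanCode D S q' T.right.head
      ring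
    · have : x' true = y true := by simpa using h1.2
      rw [this]
      exact hr₂
  · obtain ⟨rfl, -⟩ := hcode _ h0.1.symm
    refine ⟨hq', ⟨_, hl, h0.2⟩, ?_⟩
    rw [h1.2.trans h1.1.symm]
    exact hr

/-- The affine rules accept the representation of a configuration iff the machine halts on it. -/
theorem accepts_iff_eval_dom (hS : Supports M (S : Set Λ)) {c : Cfg Γ Λ} {x : Bool → ℕ}
    (hx : CfgRepresents D S c x) :
    (affineRules M D S).Accepts x ↔ (StateTransition.eval (step M) c).Dom := by
  constructor
  · intro h
    induction h using Relation.ReflTransGen.head_induction_on generalizing c with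
    | refl =>
      obtain ⟨-, ⟨l, -, h⟩, -⟩ := hx
      change 1 = _ at h
      rw [scanCode] at h
      omega
    | head hs _ ih =>
      rcases cfgRepresents_of_affine_step hS hx hs with h | ⟨c', hc', hx'⟩
      · exact Part.dom_iff_mem.2 ⟨c, mem_eval.2 ⟨.refl, h⟩⟩
      · rw [reaches_eval (Relation.ReflTransGen.single hc')]
        exact ih hx'
  · intro h
    obtain ⟨b, hb⟩ := Part.dom_iff_mem.1 h
    obtain ⟨hcb, hhalt⟩ := mem_eval.1 hb
    clear h hb
    induction hcb using Relation.ReflTransGen.head_induction_on generalizing x with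
    | refl => exact .single (affine_step_of_halt hx hhalt)
    | head hs _ ih =>
      obtain ⟨x', hs', hx'⟩ := exists_affine_step hS hx hs
      exact .head hs' (ih hx')

end Turing.TM0

/-! ### A Turing machine with an undecidable halting problem -/

namespace Turing.PartrecToTM2

instance : Fintype K' := ⟨{.main, .rev, .aux, .stack}, fun k => by cases k <;> simp⟩

theorem trNat_eq_map_bits (n : ℕ) :
    trNat n = n.bits.map fun b => bif b then Γ'.bit1 else Γ'.bit0 := by
  have hpos : ∀ p : PosNum,
      trPosNum p = (p : ℕ).bits.map fun b => bif b then Γ'.bit1 else Γ'.bit0 := by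
    intro p
    induction p with
    | one => simp [trPosNum]
    | bit0 p ih =>
      have : (p : ℕ) ≠ 0 := (PosNum.cast_pos p).ne'
      rw [trPosNum, ih, PosNum.cast_bit0, ← two_mul, Nat.bit0_bits _ this]
      rfl
    | bit1 p ih =>
      rw [trPosNum, ih, PosNum.cast_bit1, ← two_mul, Nat.bit1_bits]
      rfl
  have hnum : ∀ p : Num, trNum p = (p : ℕ).bits.map fun b => bif b then Γ'.bit1 else Γ'.bit0 := by
    rintro (_ | p)
    · simp [trNum]
    · exact hpos p
  rw [trNat, hnum, Num.to_of_nat]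

end Turing.PartrecToTM2

/-- There is a Turing machine, with finitely many accessible states and a finite alphabet, that
halts on the binary representation of `n`, after a start symbol, iff the program with number `n`
halts on input `0`. -/
theorem exists_universal_machine : ∃ (Γ Λ : Type) (_ : Inhabited Γ) (_ : Fintype Γ)
    (_ : Inhabited Λ) (M : TM0.Machine Γ Λ) (S : Finset Λ) (s : Γ) (d : Bool → Γ),
    TM0.Supports M (S : Set Λ) ∧
      ∀ n : ℕ, (eval (TM0.step M) (TM0.init (s :: n.bits.reverse.map d))).Dom ↔
        ((Denumerable.ofNat Nat.Partrec.Code n).eval 0).Dom := by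
  have hf : Partrec fun n : ℕ => (Denumerable.ofNat Nat.Partrec.Code n).eval 0 :=
    Nat.Partrec.Code.eval_part.comp (Computable.ofNat _) (Computable.const 0)
  obtain ⟨c, hc⟩ := ToPartrec.Code.exists_code (Nat.Partrec'.part_iff₁.2 hf)
  let _ : Inhabited PartrecToTM2.Λ' := ⟨PartrecToTM2.trNormal c .halt⟩
  let M₁ := TM2to1.tr PartrecToTM2.tr
  let h : PartrecToTM2.Γ' → TM2to1.Γ' PartrecToTM2.K' fun _ => PartrecToTM2.Γ' :=
    fun a => (false, Function.update (fun _ => none) .main (some a))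
  let s : TM2to1.Γ' PartrecToTM2.K' fun _ => PartrecToTM2.Γ' := (true, (h .cons).2)
  refine ⟨TM2to1.Γ' PartrecToTM2.K' fun _ => PartrecToTM2.Γ', TM1to0.Λ' M₁, inferInstance,
    inferInstance, inferInstance, TM1to0.tr M₁,
    TM1to0.trStmts M₁ (TM2to1.trSupp PartrecToTM2.tr (PartrecToTM2.codeSupp c .halt)),
    s, fun b => h (bif b then .bit1 else .bit0),
    TM1to0.tr_supports _ (TM2to1.tr_supports _ (PartrecToTM2.tr_supports c .halt)), fun n => ?_⟩
  have htape : TM2to1.trInit PartrecToTM2.K'.main (PartrecToTM2.trList [n]) =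
      s :: n.bits.reverse.map fun b => h (bif b then .bit1 else .bit0) := by
    have hrev : (PartrecToTM2.trList [n]).reverse = PartrecToTM2.Γ'.cons ::
        n.bits.reverse.map fun b => bif b then .bit1 else .bit0 := by
      simp [PartrecToTM2.trNat_eq_map_bits]
    simp only [TM2to1.trInit]
    rw [hrev]
    exact congrArg (s :: ·) List.map_map
  have hinit : PartrecToTM2.init c [n] =
      TM2.init PartrecToTM2.K'.main (PartrecToTM2.trList [n]) := by
    simp only [PartrecToTM2.init, TM2.init]
    congr 1
    funext k
    cases k <;> simp [PartrecToTM2.K'.elim]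
  have h0 := StateTransition.tr_eval_dom (TM1to0.tr_respects M₁)
    (a₁ := TM1.init (TM2to1.trInit PartrecToTM2.K'.main (PartrecToTM2.trList [n]))) rfl
  have h1 := StateTransition.tr_eval_dom (TM2to1.tr_respects PartrecToTM2.tr)
    (TM2to1.trCfg_init PartrecToTM2.K'.main (PartrecToTM2.trList [n]))
  have h2 : (eval (TM2.step PartrecToTM2.tr) (PartrecToTM2.init c [n])).Dom ↔ (c.eval [n]).Dom := by
    rw [PartrecToTM2.tr_eval]
    rfl
  have h3 : (c.eval [n]).Dom ↔ ((Denumerable.ofNat Nat.Partrec.Code n).eval 0).Dom := by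
    rw [show c.eval [n] = _ from hc ⟨[n], rfl⟩]
    rfl
  rw [← htape, ← h3, ← h2, hinit, ← h1]
  exact h0

theorem Primrec.nat_bits : Primrec Nat.bits := by
  have hg : Primrec₂ fun (_ : Unit) (l : List (List Bool)) =>
      if l.length = 0 then some [] else (l[l.length / 2]?).map fun t => l.length.bodd :: t := by
    have hlen : Primrec fun p : Unit × List (List Bool) => p.2.length :=
      Primrec.list_length.comp Primrec.snd
    refine Primrec.ite (Primrec.eq.comp hlen (Primrec.const 0)) (Primrec.const _) ?_
    refine Primrec.option_map (Primrec.list_getElem?.comp Primrec.snd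
      (Primrec.nat_div.comp hlen (Primrec.const 2))) ?_
    exact Primrec.list_cons.comp (Primrec.nat_bodd.comp (hlen.comp Primrec.fst)) Primrec.snd
  refine (Primrec.nat_strong_rec (fun (_ : Unit) n => n.bits) hg fun _ n => ?_).comp
    (Primrec.const ()) Primrec.id
  rcases Nat.eq_zero_or_pos n with rfl | hn
  · simp
  · have hlt : n / 2 < n := Nat.div_lt_self hn one_lt_two
    have hb : (Nat.bit n.bodd (n / 2)).bits = n.bodd :: (n / 2).bits := by
      refine Nat.bits_append_bit _ _ fun h0 => ?_
      have := Nat.bodd_add_div2 n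
      rw [Nat.div2_val, h0] at this
      cases hbod : n.bodd
      · simp [hbod] at this
        omega
      · rfl
    rw [← Nat.div2_val, Nat.bit_bodd_div2, Nat.div2_val] at hb
    simp [hn.ne', hlt, hb]

/-- A finite family of affine rules and a computable family of pairs for which acceptance is
undecidable. -/
theorem exists_affineRules_not_computablePred : ∃ (R : Type) (_ : Fintype R) (P : AffineRules R)
    (x : ℕ → Bool → ℕ), (∀ j, Computable fun n => x n j) ∧
      ¬ ComputablePred fun n => P.Accepts (x n) := by
  obtain ⟨Γ, Λ, _, _, _, M, S, s, d, hS, hM⟩ := exists_universal_machine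
  obtain ⟨D⟩ : Nonempty (DigitCode Γ) := inferInstance
  let right : ℕ → ℕ := fun n =>
    (n.bits.reverse.map d).foldr (fun a r => D.B * r + D.sym a) 0
  have hright : Computable right := by
    have hsym : Primrec fun b => D.sym (d b) := Primrec.dom_bool _
    have : Primrec fun n : ℕ => n.bits.foldl (fun r b => D.B * r + D.sym (d b)) 0 :=
      Primrec.list_foldl Primrec.nat_bits (Primrec.const 0)
        (Primrec.nat_add.comp
          (Primrec.nat_mul.comp (Primrec.const D.B) (Primrec.fst.comp Primrec.snd))
          (hsym.comp (Primrec.snd.comp Primrec.snd))).to₂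
    refine (this.of_eq fun n => ?_).to_comp
    simp only [right]
    rw [List.foldr_map, List.foldr_reverse]
  refine ⟨S × Γ × Γ, inferInstance, TM0.affineRules M D S,
    fun n j => bif j then right n else TM0.scanCode D S default s, fun j => ?_, fun hcomp => ?_⟩
  · cases j
    · exact Computable.const _
    · exact hright
  · refine ComputablePred.halting_problem 0 ?_
    have hiff : ∀ n, (TM0.affineRules M D S).Accepts
        (fun j => bif j then right n else TM0.scanCode D S default s) ↔
          ((Denumerable.ofNat Nat.Partrec.Code n).eval 0).Dom := by
      intro n
      rw [← hM]
      refine TM0.accepts_iff_eval_dom hS ⟨hS.1, ⟨0, ?_, ?_⟩, ?_⟩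
      · exact DigitCode.represents_mk D []
      · simp [TM0.init, Tape.mk₁, Tape.mk₂, Tape.mk']
      · simpa [TM0.init, Tape.mk₁, Tape.mk₂, Tape.mk', right] using
          DigitCode.represents_mk D (n.bits.reverse.map d)
    obtain ⟨hdec, hcomp⟩ := hcomp
    refine ComputablePred.of_eq (p := fun c : Nat.Partrec.Code => (TM0.affineRules M D S).Accepts
      (fun j => bif j then right (Encodable.encode c) else TM0.scanCode D S default s))
      ⟨fun c => hdec (Encodable.encode c), hcomp.comp Computable.encode⟩ fun c => ?_
    rw [hiff, Denumerable.ofNat_encode]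

/-! ### Computability of the reduction -/

theorem Computable.int_natCast {α : Type*} [Primcodable α] {f : α → ℕ} (hf : Computable f) :
    Computable fun a => (f a : ℤ) := by
  have h : Primrec fun n : ℕ => (n : ℤ) := by
    rw [← Primrec.encode_iff]
    exact Primrec.nat_double.of_eq fun n => rfl
  exact h.to_comp.comp hf

theorem computable_intNum {α : Type*} [Primcodable α] (m : ℕ) {f : α → ℤ} (hf : Computable f) :
    Computable fun a => intNum m (f a) := by
  have h : Primrec fun z : ℤ => intNum m z := by
    refine Primrec.pair (Primrec.fin_curry.2 (Primrec.fin_curry₁.2 fun j => ?_).swap)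
      (Primrec.const 0)
    by_cases hj : (j : ℕ) = 0
    · simp only [hj, if_true]
      exact Primrec.id
    · simpa [hj] using Primrec.const 0
  exact h.to_comp.comp hf

/-- The code of an automaton is computable from its integer weights. -/
theorem computable_encode_intAut {α S C : Type*} [Primcodable α] [Fintype S] [Nonempty S]
    [Fintype C] [Nonempty C] (k m : ℕ) (W : α → Option S → C → Bool → S → ℤ)
    (hW : ∀ q c b s, Computable fun a => W a q c b s) :
    Computable fun a => (intAut k m (W a)).encode := by
  have hform : ∀ q c b, Computable fun a => List.ofFn (intForm m (W a q c b)).coeff := by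
    intro q c b
    have hcoeff : ∀ o : Option S, Computable fun a => o.map fun s => intNum m (W a q c b s) := by
      rintro (_ | s)
      · exact Computable.const none
      · exact Computable.option_some.comp (computable_intNum m (hW q c b s))
    exact Computable.list_ofFn fun i => hcoeff ((Fintype.equivFin (Option S)).symm i)
  have htable : Computable fun a => List.ofFn fun q : Fin (Fintype.card (Option S)) =>
      List.ofFn fun i : Fin k => List.ofFn fun c : Fin (Fintype.card C) =>
        ((intSWTA k m (W a)).δ q i c).map fun p => (List.ofFn p.1.coeff, List.ofFn p.2.coeff) :=
    Computable.list_ofFn fun q => Computable.list_ofFn fun _ => Computable.list_ofFn fun c =>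
      Computable.option_some.comp ((hform ((Fintype.equivFin (Option S)).symm q) _ _).pair
        (hform ((Fintype.equivFin (Option S)).symm q) _ _))
  exact (Computable.const (Fintype.card (Option S))).pair <|
    (Computable.const (Fintype.card C)).pair <|
    (Computable.const ((intSWTA k m (0 : Option S → C → Bool → S → ℤ)).root : ℕ)).pair <|
    (Computable.const (List.ofFn fun q =>
      decide (q ∈ (intSWTA k m (0 : Option S → C → Bool → S → ℤ)).leaves))).pair htable

theorem AffineRules.computable_weight {α R : Type*} [Primcodable α] (P : AffineRules R)
    {x : α → Bool → ℕ} (hx : ∀ j, Computable fun a => x a j) (q : Option Reg) (c : R ⊕ Bool)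
    (b : Bool) (s : Reg) : Computable fun a => P.weight (x a) q c b s := by
  -- The weights depend on `x` only in the linear forms of the state `start`.
  by_cases hq : q = some .start
  · subst hq
    by_cases hs : s = .one
    · subst hs
      exact (Computable.int_natCast (hx b)).of_eq fun a => by simp [weight]
    · exact (Computable.const (P.weight 0 (some .start) c b s)).of_eq fun a => by
        simp [weight, hs]
  · refine (Computable.const (P.weight 0 q c b s)).of_eq fun a => ?_
    rcases q with _ | (_ | _ | _ | _ | _ | _)
    case some.start => exact absurd rfl hq
    all_goals cases b <;> cases c <;> rfl

theorem mainTheorem6 (k m : ℕ) (hk : 0 < k) (hm : 0 < m) :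
    ¬ ∃ f : SWTACode m × SWTACode m →. Bool, Partrec f ∧
      ∀ A B : FinSWTA k m, ∃ b ∈ f (A.encode, B.encode),
        (b = true ↔ A.language ∩ B.language = ∅) := by
  rintro ⟨f, hf, hfAB⟩
  obtain ⟨R, _, P, x, hx, hP⟩ := exists_affineRules_not_computablePred
  refine hP ?_
  let A : ℕ → FinSWTA k m := fun n => intAut k m (P.weight (x n))
  have hA : Computable fun n => ((A n).encode, (zeroAut k m).encode) :=
    (computable_encode_intAut k m _ (P.computable_weight hx)).pair (Computable.const _)
  choose b hb hbiff using fun n => hfAB (A n) (zeroAut k m)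
  have hbcomp : Computable b :=
    (hf.comp hA).of_eq fun n => Part.eq_some_iff.2 (hb n)
  have hiff : ∀ n, P.Accepts (x n) ↔ (!b n) = true := by
    intro n
    rw [← P.exists_forall_branchValue_iff_accepts, ← language_inter_zeroAut hk hm,
      Set.nonempty_iff_ne_empty, Ne, ← hbiff n]
    simp
  classical
  refine ⟨inferInstance, (Primrec.not.to_comp.comp hbcomp).of_eq fun n => ?_⟩
  rw [Bool.eq_iff_iff, decide_eq_true_iff]
  exact (hiff n).symm
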